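/- Setting. A connected planar trivalent graph $G$ is given by a crossing-free diagram $D$ in the plane of a connected, oriented trivalent graph (loops and multiple edges are allowed, and so is a single closed curve without vertices). $G$ is framed: each edge $e$ carries $p_e$ positive and $n_e$ negative half twists relative to the blackboard framing. A positive coloring $c$ assigns a positive integer to each edge so that at every vertex the colors of the entering edges and the colors of the leaving edges have the same sum. Let $V$ be the set of vertices. State sum. Draw a small circle around each vertex. The crossings are the points where an edge enters the circle around its terminal vertex. The regions are the regions of the sphere cut out by $D$ and the interiors of the circles. A crossing has three corners: north (inside the circle), west and east (on the left and on the right of the entering edge). Fix an initial point $\delta$ on an edge. A state is a choice of a corner at each crossing such that each region not adjacent to $\delta$ contains exactly one chosen corner and the regions adjacent to $\delta$ contain none. At a crossing on an edge of color $i$, the north, west and east corners have weights $t^{i/2}-t^{-i/2}$, $t^{i/2}$ and $t^{-i/2}$. Let $\langle D|\delta\rangle$ be the sum over all states of the products of the weights of the chosen corners. Normalization. The index of a region of the plane is $0$ for the unbounded region, and on the right of an edge of color $i$ it is larger by $i$ than on the left. Put $|\delta|=t^{r}-t^{l}$, where $r$ and $l$ are the indices of the regions on the right and on the left of $\delta$.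 Put $\mathcal F=\prod_e t^{c(e)(p_e-n_e)/4}$. Replace each edge $e$ by $c(e)$ parallel strands, joined at the vertices without crossings, and let $\mathcal C=t^{(a-b)/2}$, where $a$ and $b$ are the numbers of clockwise and of counterclockwise closed curves obtained. Define $$\Delta_{(G,c)}(t)=\frac{\mathcal F\,\mathcal C}{|\delta|\,(t^{1/2}-t^{-1/2})^{|V|-1}}\,\langle D|\delta\rangle ,$$ a rational function of $t^{1/4}$. Theorem. For every connected planar trivalent graph $G$ with a positive coloring $c$, one has $\Delta_{(G,c)}(t)\neq 0$ (for every choice of the initial point $\delta$). -/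

import Mathlib

namespace MOY

/-- The half-edges of an oriented graph with edge set `E`: `(e, true)` is the half of `e` that
leaves its initial vertex, `(e, false)` is the half of `e` that enters its terminal vertex. -/
abbrev HalfEdge (E : Type*) := E × Bool

/-- The involution exchanging the two halves of every edge. -/
def flip (E : Type*) : Equiv.Perm (HalfEdge E) :=
  Equiv.prodCongr (Equiv.refl E) Equiv.boolNot

/-- `rot` sends a half-edge to the next half-edge, in counterclockwise order, around the vertex
at which it is attached. Travelling along a half-edge `h` away from its vertex and turning at the
end of the edge so that the same region stays on the left, one continues with `faceNext rot h`. -/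
def faceNext {E : Type*} (rot : Equiv.Perm (HalfEdge E)) : Equiv.Perm (HalfEdge E) :=
  (flip E).trans rot.symm

/-- The points at which half-edges meet: the cycles of the rotation. -/
abbrev Node {E : Type*} (rot : Equiv.Perm (HalfEdge E)) :=
  Quotient (Equiv.Perm.SameCycle.setoid rot)

/-- The regions into which the graph cuts the sphere: the cycles of `faceNext`. -/
abbrev Face {E : Type*} (rot : Equiv.Perm (HalfEdge E)) :=
  Quotient (Equiv.Perm.SameCycle.setoid (faceNext rot))

/-- The node at which a half-edge is attached. -/
def nodeOf {E : Type*} (rot : Equiv.Perm (HalfEdge E)) (h : HalfEdge E) : Node rot :=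
  Quotient.mk _ h

/-- The region on the left of a half-edge, as seen when leaving its node. -/
def faceOf {E : Type*} (rot : Equiv.Perm (HalfEdge E)) (h : HalfEdge E) : Face rot :=
  Quotient.mk _ h

/-- The number of half-edges attached at a node. -/
noncomputable def valence {E : Type*} {rot : Equiv.Perm (HalfEdge E)} (v : Node rot) : ℕ :=
  Nat.card {h : HalfEdge E // nodeOf rot h = v}

/-- A crossing-free diagram in the plane of a connected, oriented, framed trivalent graph, up to
planar isotopy. It is given by its rotation system, the unbounded region, and the framing.

The nodes are the vertices of the graph (valence 3) and auxiliary points in the interior of edges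
(valence 2). The latter are not vertices of the graph; they allow an edge which is a closed curve
without any vertex, so that the diagram of the trivial knot is included. Loops and multiple edges
are allowed. -/
structure PlanarDiagram (E : Type*) where
  rot : Equiv.Perm (HalfEdge E)
  valence_eq : ∀ v : Node rot, valence v = 2 ∨ valence v = 3
  connected : ∀ u v : Node rot,
    Relation.EqvGen
      (fun x y => ∃ e : E, nodeOf rot (e, true) = x ∧ nodeOf rot (e, false) = y) u v
  /-- Euler's formula: the rotation system describes an embedding in the sphere. -/
  euler : Nat.card (Node rot) + Nat.card (Face rot) = Nat.card E + 2
  /-- The unbounded region. -/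
  outer : Face rot
  /-- The framing, relative to the blackboard framing: the number of positive half twists minus
  the number of negative half twists on each edge. -/
  twist : E → ℤ

namespace PlanarDiagram

variable {E : Type*} (D : PlanarDiagram E)

/-- The initial point of an edge. -/
def tail (e : E) : Node D.rot := nodeOf D.rot (e, true)

/-- The terminal point of an edge. -/
def head (e : E) : Node D.rot := nodeOf D.rot (e, false)

/-- The region on the left-hand side of an edge. -/
def left (e : E) : Face D.rot := faceOf D.rot (e, true)

/-- The region on the right-hand side of an edge. -/
def right (e : E) : Face D.rot := faceOf D.rot (e, false)

/-- The vertices of the trivalent graph. -/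
abbrev Vertex := {v : Node D.rot // valence v = 3}

open Classical in
/-- A coloring is balanced if at every node the colors of the entering edges and the colors of
the leaving edges have the same sum. (At a node of valence 2, this says that the color and the
orientation do not change along the edge if the coloring is positive.) -/
def IsBalanced [Fintype E] (c : E → ℕ) : Prop :=
  ∀ v : Node D.rot,
    ∑ e ∈ Finset.univ.filter (fun e : E => D.head e = v), c e =
      ∑ e ∈ Finset.univ.filter (fun e : E => D.tail e = v), c e

/-! ### Crossings, regions, Kauffman states -/

/-- A small circle is drawn around every vertex. The crossings are the points where an edge that
enters a vertex meets the circle around it; there are no other crossings. -/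
abbrev Crossing := {e : E // valence (D.head e) = 3}

/-- The regions: those cut out by the diagram, and the interiors of the circles. -/
abbrev Region := Face D.rot ⊕ D.Vertex

/-- The corners around a crossing: inside the circle, and on the left and on the right of the
entering edge. -/
inductive Corner
  | north
  | west
  | east
  deriving DecidableEq

instance : Fintype Corner where
  elems := {Corner.north, Corner.west, Corner.east}
  complete := by intro x; cases x <;> simp

/-- The region that contains a given corner. -/
def regionAt (p : D.Crossing) : Corner → D.Region
  | Corner.north => Sum.inr ⟨D.head p.1, p.2⟩
  | Corner.west => Sum.inl (D.left p.1)
  | Corner.east => Sum.inl (D.right p.1)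

/-- Kauffman states for an initial point on the edge `δ`: choices of a corner at each crossing
such that every region other than the two regions adjacent to `δ` contains exactly one chosen
corner and the latter two contain none. -/
def IsState (δ : E) (s : D.Crossing → Corner) : Prop :=
  Set.BijOn (fun p => D.regionAt p (s p)) Set.univ
    {R | R ≠ Sum.inl (D.left δ) ∧ R ≠ Sum.inl (D.right δ)}

end PlanarDiagram

/-- `qpow k` is `t ^ (k / 4)`, in the field of rational functions in the variable `t ^ (1 / 4)`. -/
noncomputable def qpow (k : ℤ) : RatFunc ℚ := (RatFunc.X : RatFunc ℚ) ^ k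

namespace PlanarDiagram

/-- The local contribution of a corner at a crossing on an edge of color `i`. -/
noncomputable def weight (i : ℕ) : Corner → RatFunc ℚ
  | Corner.north => qpow (2 * i) - qpow (-(2 * i))
  | Corner.west => qpow (2 * i)
  | Corner.east => qpow (-(2 * i))

variable {E : Type*} (D : PlanarDiagram E)

open Classical in
/-- The state sum `⟨D | δ⟩`. -/
noncomputable def stateSum [Fintype E] (c : E → ℕ) (δ : E) : RatFunc ℚ :=
  ∑ s ∈ Finset.univ.filter (D.IsState δ), ∏ p : D.Crossing, weight (c p.1) (s p)

/-! ### The index of a region and the normalizing factor of the initial point -/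

/-- The rule that determines the index of the regions of the plane: it is `0` on the unbounded
region, and on the right of an edge of color `i` it is larger by `i` than on the left. -/
def IsIndex (c : E → ℕ) (ind : Face D.rot → ℤ) : Prop :=
  ind D.outer = 0 ∧ ∀ e : E, ind (D.right e) - ind (D.left e) = c e

/-- The index of the regions: the function determined by `IsIndex`. -/
noncomputable def index (c : E → ℕ) : Face D.rot → ℤ :=
  Classical.epsilon (D.IsIndex c)

/-- The factor `|δ|`. -/
noncomputable def pointFactor (c : E → ℕ) (δ : E) : RatFunc ℚ :=
  qpow (4 * D.index c (D.right δ)) - qpow (4 * D.index c (D.left δ))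

/-! ### The framing factor and the colored curliness -/

/-- The framing factor of the diagram. -/
noncomputable def framingFactor [Fintype E] (c : E → ℕ) : RatFunc ℚ :=
  ∏ e : E, qpow (c e * D.twist e)

/-- Every edge of color `i` is replaced by `i` parallel strands; `⟨e, k⟩` is the `k`-th strand
along `e`, counted from the left and starting with `0`. -/
abbrev Strand (c : E → ℕ) := Σ e : E, Fin (c e)

/-- The number of strands entering the terminal point of `e` on the left of those along `e`:
if the half-edge that precedes that of `e` in the counterclockwise order belongs to another
entering edge, then this edge is on the left of `e`. -/
def enterOffset (c : E → ℕ) (e : E) : ℕ :=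
  match D.rot.symm (e, false) with
  | (e', false) => c e'
  | (_, true) => 0

/-- The number of strands leaving the initial point of `e` on the left of those along `e`:
if the half-edge that follows that of `e` in the counterclockwise order belongs to another
leaving edge, then this edge is on the left of `e`. -/
def leaveOffset (c : E → ℕ) (e : E) : ℕ :=
  match D.rot (e, true) with
  | (e', true) => c e'
  | (_, false) => 0

/-- At every node the entering strands are joined to the leaving strands without crossings:
the `n`-th entering strand from the left continues as the `n`-th leaving strand. -/
def Joined (c : E → ℕ) (x y : Strand c) : Prop :=
  D.head x.1 = D.tail y.1 ∧ D.enterOffset c x.1 + x.2 = D.leaveOffset c y.1 + y.2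

/-- The closed curves formed by the strands. -/
abbrev Curve (c : E → ℕ) := Quot (D.Joined c)

/-- `w` is the winding number of the closed curve `γ` around the points of the regions: it
vanishes on the unbounded region, and crossing a strand of `γ` from its right to its left
increases it by one. -/
def IsWindingNumber {c : E → ℕ} (γ : D.Curve c) (w : Face D.rot → ℤ) : Prop :=
  w D.outer = 0 ∧
    ∀ e : E, w (D.left e) - w (D.right e) =
      Nat.card {k : Fin (c e) // Quot.mk (D.Joined c) ⟨e, k⟩ = γ}

/-- The curve (a simple closed curve in the plane) is oriented counterclockwise. -/
def IsCounterclockwise {c : E → ℕ} (γ : D.Curve c) : Prop :=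
  ∃ w, D.IsWindingNumber γ w ∧ ∀ f, 0 ≤ w f

/-- The curve (a simple closed curve in the plane) is oriented clockwise. -/
def IsClockwise {c : E → ℕ} (γ : D.Curve c) : Prop :=
  ∃ w, D.IsWindingNumber γ w ∧ ∀ f, w f ≤ 0

/-- The colored curliness: `t ^ (1 / 2)` to the number of clockwise curves minus the number of
counterclockwise curves. -/
noncomputable def curliness (c : E → ℕ) : RatFunc ℚ :=
  qpow (2 * ((Nat.card {γ : D.Curve c // D.IsClockwise γ} : ℤ) -
    (Nat.card {γ : D.Curve c // D.IsCounterclockwise γ} : ℤ)))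

/-! ### The normalized Alexander polynomial -/

/-- The normalized Alexander polynomial, computed with an initial point on the edge `δ`. -/
noncomputable def alexander [Fintype E] (c : E → ℕ) (δ : E) : RatFunc ℚ :=
  D.framingFactor c * D.curliness c /
      (D.pointFactor c δ * (qpow 2 - qpow (-2)) ^ ((Nat.card D.Vertex : ℤ) - 1)) *
    D.stateSum c δ

end PlanarDiagram

end MOY

/-! The other factors are powers of `t ^ (1 / 4)` or differences of two distinct powers, so only the
state sum can vanish. For positive colors every corner weight is positive at `t ^ (1 / 4) = 2`; no
cancellation is possible there, and one state suffices.

A state is a nonzero term in the determinant of a crossings-by-regions matrix supported on the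
corners. Euler's formula makes the matrix square (`IsBalanced.card_crossing`). A kernel vector is a
function on the regions whose jump across each crossing edge is its color times the value at the
head vertex. Jumps form a flow (`isFlow_jump`), and an energy identity makes the ratio jump/color
constant (`IsBalanced.potential_const`). The vector vanishes on both sides of `δ`, so this constant
is zero and, by connectedness, so is the vector. -/

namespace MOY

/-! ### Elements of `ℚ(t ^ (1 / 4))` that are positive at `t ^ (1 / 4) = 2` -/

/-- `f` is a Laurent polynomial whose value at `2` is positive. -/
def IsPositive (f : RatFunc ℚ) : Prop :=
  ∃ (m : ℕ) (p : Polynomial ℚ), 0 < p.eval 2 ∧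
    f * RatFunc.X ^ m = algebraMap (Polynomial ℚ) (RatFunc ℚ) p

namespace IsPositive

theorem ne_zero {f : RatFunc ℚ} (hf : IsPositive f) : f ≠ 0 := by
  rintro rfl
  obtain ⟨m, p, hp, h⟩ := hf
  rw [zero_mul, eq_comm, FaithfulSMul.algebraMap_eq_zero_iff] at h
  simp [h] at hp

theorem mul {f g : RatFunc ℚ} (hf : IsPositive f) (hg : IsPositive g) : IsPositive (f * g) := by
  obtain ⟨m, p, hp, h⟩ := hf
  obtain ⟨n, q, hq, k⟩ := hg
  refine ⟨m + n, p * q, by rw [Polynomial.eval_mul]; positivity, ?_⟩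
  rw [map_mul, ← h, ← k]
  ring

theorem add {f g : RatFunc ℚ} (hf : IsPositive f) (hg : IsPositive g) : IsPositive (f + g) := by
  obtain ⟨m, p, hp, h⟩ := hf
  obtain ⟨n, q, hq, k⟩ := hg
  refine ⟨m + n, p * Polynomial.X ^ n + q * Polynomial.X ^ m, ?_, ?_⟩
  · simp only [Polynomial.eval_add, Polynomial.eval_mul, Polynomial.eval_pow, Polynomial.eval_X]
    positivity
  · simp only [map_add, map_mul, map_pow, RatFunc.algebraMap_X, ← h, ← k]
    ring

theorem one : IsPositive 1 := ⟨0, 1, by simp, by simp⟩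

end IsPositive

theorem isPositive_qpow_natCast (n : ℕ) : IsPositive (qpow n) :=
  ⟨0, Polynomial.X ^ n, by simp, by simp [qpow]⟩

theorem qpow_ne_zero (k : ℤ) : qpow k ≠ 0 := zpow_ne_zero _ RatFunc.X_ne_zero

theorem qpow_add (k l : ℤ) : qpow (k + l) = qpow k * qpow l := zpow_add₀ RatFunc.X_ne_zero k l

theorem isPositive_qpow_neg_natCast (n : ℕ) : IsPositive (qpow (-n)) :=
  ⟨n, 1, by simp, by simp [qpow, RatFunc.X_ne_zero]⟩

theorem isPositive_qpow (k : ℤ) : IsPositive (qpow k) := by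
  obtain ⟨n, rfl | rfl⟩ := k.eq_nat_or_neg
  · exact isPositive_qpow_natCast n
  · exact isPositive_qpow_neg_natCast n

theorem isPositive_qpow_sub_qpow {k l : ℤ} (h : l < k) : IsPositive (qpow k - qpow l) := by
  obtain ⟨n, hn⟩ := Int.eq_ofNat_of_zero_le (sub_nonneg.2 h.le)
  obtain rfl : k = l + n := by omega
  have hn : n ≠ 0 := by omega
  rw [qpow_add, show qpow l * qpow n - qpow l = qpow l * (qpow n - 1) by ring]
  refine (isPositive_qpow l).mul ⟨0, Polynomial.X ^ n - 1, ?_, by simp [qpow]⟩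
  simpa using one_lt_pow₀ (one_lt_two : (1 : ℚ) < 2) hn

theorem PlanarDiagram.isPositive_weight {i : ℕ} (hi : 0 < i) (s : PlanarDiagram.Corner) :
    IsPositive (PlanarDiagram.weight i s) := by
  cases s
  · exact isPositive_qpow_sub_qpow (by omega)
  · exact isPositive_qpow _
  · exact isPositive_qpow _

/-! ### Rank of a matrix whose kernel consists of constant vectors -/

/-- Evaluation at one coordinate is injective on such a kernel, whose dimension is therefore at most
one. -/
theorem card_le_rank_add_one {m n : Type*} [Fintype m] [Fintype n] (A : Matrix m n ℚ)
    (h : ∀ y, A.mulVec y = 0 → ∀ i j, y i = y j) : Fintype.card n ≤ A.rank + 1 := by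
  classical
  have hrank := A.mulVecLin.finrank_range_add_finrank_ker
  rw [Module.finrank_fintype_fun_eq_card] at hrank
  rcases isEmpty_or_nonempty n with _ | ⟨⟨i⟩⟩
  · simp
  have hker : Module.finrank ℚ (LinearMap.ker A.mulVecLin) ≤ 1 := by
    rw [← Module.finrank_self ℚ]
    refine LinearMap.finrank_le_finrank_of_injective
      (f := (LinearMap.proj i).comp (LinearMap.ker A.mulVecLin).subtype) ?_
    intro x y hxy
    ext j
    have hx := h x.1 (LinearMap.mem_ker.1 x.2) j i
    have hy := h y.1 (LinearMap.mem_ker.1 y.2) j i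
    rw [hx, hy]
    exact hxy
  rw [Matrix.rank]
  omega

namespace PlanarDiagram

variable {E : Type*} (D : PlanarDiagram E)

/-! ### Connectedness -/

/-- Connectedness as an induction principle: `flip` and `rot` together act transitively on
half-edges. -/
theorem forall_halfEdge_of_invariant (P : HalfEdge E → Prop)
    (hflip : ∀ h, P (flip E h) ↔ P h) (hrot : ∀ h, P (D.rot h) ↔ P h)
    {h : HalfEdge E} (hh : P h) (k : HalfEdge E) : P k := by
  have hpow : ∀ (n : ℕ) h, P ((D.rot ^ n) h) ↔ P h := by
    intro n
    induction n with
    | zero => simp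
    | succ n ih => intro h; rw [pow_succ', Equiv.Perm.mul_apply, hrot, ih]
  have hcycle : ∀ a b, nodeOf D.rot a = nodeOf D.rot b → (P a ↔ P b) := by
    intro a b hab
    obtain ⟨i, rfl⟩ := Quotient.exact hab
    obtain ⟨n, rfl | rfl⟩ := i.eq_nat_or_neg
    · rw [zpow_natCast, hpow]
    · rw [← hpow n ((D.rot ^ (-(n : ℤ))) a)]
      simp
  have hconn : ∀ u v, Relation.EqvGen
      (fun x y => ∃ e : E, nodeOf D.rot (e, true) = x ∧ nodeOf D.rot (e, false) = y) u v →
      ((∀ a, nodeOf D.rot a = u → P a) ↔ (∀ a, nodeOf D.rot a = v → P a)) := by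
    intro u v huv
    induction huv with
    | rel x y hxy =>
      obtain ⟨e, rfl, rfl⟩ := hxy
      have hx : (∀ a, nodeOf D.rot a = nodeOf D.rot (e, true) → P a) ↔ P (e, true) :=
        ⟨fun H => H _ rfl, fun H a ha => (hcycle _ _ ha).2 H⟩
      have hy : (∀ a, nodeOf D.rot a = nodeOf D.rot (e, false) → P a) ↔ P (e, false) :=
        ⟨fun H => H _ rfl, fun H a ha => (hcycle _ _ ha).2 H⟩
      rw [hx, hy]
      exact (hflip (e, true)).symm
    | refl => rfl
    | symm _ _ _ ih => exact ih.symm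
    | trans _ _ _ _ _ ih₁ ih₂ => exact ih₁.trans ih₂
  exact (hconn _ _ (D.connected (nodeOf D.rot h) (nodeOf D.rot k))).1
    (fun a ha => (hcycle _ _ ha).2 hh) k rfl

/-! ### Regions next to a half-edge -/

/-- By definition `faceNext` carries `flip E h` to `D.rot.symm h`. -/
theorem faceOf_rot_symm (h : HalfEdge E) :
    faceOf D.rot (D.rot.symm h) = faceOf D.rot (flip E h) := by
  refine Quotient.sound (Equiv.Perm.SameCycle.symm ⟨1, ?_⟩)
  obtain ⟨e, b⟩ := h
  simp [faceNext, flip]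

theorem nodeOf_rot (h : HalfEdge E) : nodeOf D.rot (D.rot h) = nodeOf D.rot h :=
  Quotient.sound (Equiv.Perm.SameCycle.symm ⟨1, by simp⟩)

theorem nodeOf_rot_symm (h : HalfEdge E) : nodeOf D.rot (D.rot.symm h) = nodeOf D.rot h := by
  rw [← D.nodeOf_rot (D.rot.symm h), Equiv.apply_symm_apply]

/-- A property of regions that does not change across edges holds everywhere or nowhere. -/
theorem forall_face_of_invariant (P : Face D.rot → Prop)
    (hP : ∀ e, P (D.left e) ↔ P (D.right e)) {f : Face D.rot} (hf : P f) (g : Face D.rot) :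
    P g := by
  have hflip : ∀ h, P (faceOf D.rot (flip E h)) ↔ P (faceOf D.rot h) := by
    rintro ⟨e, b⟩
    cases b
    · exact hP e
    · exact (hP e).symm
  obtain ⟨h, rfl⟩ := Quotient.exists_rep f
  obtain ⟨k, rfl⟩ := Quotient.exists_rep g
  refine D.forall_halfEdge_of_invariant (fun h => P (faceOf D.rot h)) hflip (fun h => ?_) hf k
  rw [← hflip (D.rot h), ← D.faceOf_rot_symm, Equiv.symm_apply_apply]

end PlanarDiagram

/-- A square matrix with trivial kernel has a nonvanishing term in the expansion of its
determinant. -/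
theorem exists_equiv_ne_zero {m n : Type*} [Fintype m] [Fintype n]
    (hcard : Fintype.card m = Fintype.card n) (A : Matrix m n ℚ)
    (h : ∀ x, A.mulVec x = 0 → x = 0) : ∃ σ : m ≃ n, ∀ i, A i (σ i) ≠ 0 := by
  classical
  let ε := Fintype.equivOfCardEq hcard
  have hdet : (A.submatrix ε.symm id).det ≠ 0 := by
    intro h0
    obtain ⟨x, hx, hAx⟩ := Matrix.exists_mulVec_eq_zero_iff.2 h0
    refine hx (h x (funext fun i => ?_))
    have := congrFun hAx (ε i)
    simpa [Matrix.mulVec, dotProduct] using this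
  rw [Matrix.det_apply] at hdet
  obtain ⟨τ, -, hτ⟩ := Finset.exists_ne_zero_of_sum_ne_zero hdet
  have hprod : ∏ j, A (ε.symm (τ j)) j ≠ 0 := by
    intro h0
    exact hτ (by simp [h0])
  refine ⟨ε.trans τ.symm, fun i => ?_⟩
  have := Finset.prod_ne_zero_iff.1 hprod (τ.symm (ε i)) (Finset.mem_univ _)
  simpa using this

namespace PlanarDiagram

variable {E : Type*} [Fintype E] (D : PlanarDiagram E)

/-! ### Flows -/

/-- `x` is a flow: at every node the total value of the entering edges agrees with that of the
leaving edges. This is stated by pairing with all functions on the nodes. -/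
def IsFlow (x : E → ℚ) : Prop :=
  ∀ z : Node D.rot → ℚ, ∑ e, z (D.head e) * x e = ∑ e, z (D.tail e) * x e

variable {D} in
theorem IsBalanced.isFlow {c : E → ℕ} (h : D.IsBalanced c) : D.IsFlow (fun e => (c e : ℚ)) := by
  classical
  intro z
  have := Fintype.ofFinite (Node D.rot)
  rw [← Finset.sum_fiberwise _ D.head, ← Finset.sum_fiberwise _ D.tail]
  refine Finset.sum_congr rfl fun v _ => ?_
  have hv : ((∑ e ∈ Finset.univ.filter (fun e : E => D.head e = v), c e : ℕ) : ℚ) =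
      (∑ e ∈ Finset.univ.filter (fun e : E => D.tail e = v), c e : ℕ) := by
    convert congrArg (Nat.cast (R := ℚ)) (h v)
  push_cast at hv
  calc _ = z v * ∑ e ∈ Finset.univ.filter (fun e : E => D.head e = v), (c e : ℚ) := by
        rw [Finset.mul_sum]
        exact Finset.sum_congr rfl fun e he => by rw [(Finset.mem_filter.1 he).2]
    _ = z v * ∑ e ∈ Finset.univ.filter (fun e : E => D.tail e = v), (c e : ℚ) := by rw [hv]
    _ = _ := by
        rw [Finset.mul_sum]
        exact Finset.sum_congr rfl fun e he => by rw [(Finset.mem_filter.1 he).2]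

/-- The jumps of a function on the regions form a flow. -/
theorem isFlow_jump (y : Face D.rot → ℚ) : D.IsFlow (fun e => y (D.right e) - y (D.left e)) := by
  intro z
  -- Reindexing by `rot.symm` fixes the node of a half-edge and replaces the region on its left by
  -- the one across the edge.
  have key := Equiv.sum_comp D.rot.symm
    (fun h => z (nodeOf D.rot h) * y (faceOf D.rot h))
  simp only [D.nodeOf_rot_symm, D.faceOf_rot_symm, Fintype.sum_prod_type, Fintype.sum_bool,
    Finset.sum_add_distrib] at key
  simp only [mul_sub, Finset.sum_sub_distrib]
  change (∑ e, z (D.tail e) * y (D.right e)) + ∑ e, z (D.head e) * y (D.left e) =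
    (∑ e, z (D.tail e) * y (D.left e)) + ∑ e, z (D.head e) * y (D.right e) at key
  linarith

variable {D} in
/-- Every flow is given by the jumps of a function on the regions. -/
theorem IsFlow.exists_jump {x : E → ℚ} (hx : D.IsFlow x) :
    ∃ y : Face D.rot → ℚ, ∀ e, y (D.right e) - y (D.left e) = x e := by
  classical
  have := Fintype.ofFinite (Node D.rot)
  have := Fintype.ofFinite (Face D.rot)
  -- `A` and `B` are the coboundary matrices of the regions and of the nodes; flows lie in the
  -- kernel of the transpose of `B`.
  let A : Matrix E (Face D.rot) ℚ := Matrix.of fun e f =>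
    (if f = D.right e then 1 else 0) - (if f = D.left e then 1 else 0)
  let B : Matrix E (Node D.rot) ℚ := Matrix.of fun e v =>
    (if v = D.head e then 1 else 0) - (if v = D.tail e then 1 else 0)
  have hA : ∀ y, A.mulVec y = fun e => y (D.right e) - y (D.left e) := by
    intro y
    ext e
    simp [A, Matrix.mulVec, dotProduct, sub_mul, Finset.sum_sub_distrib]
  have hB : ∀ z, B.mulVec z = fun e => z (D.head e) - z (D.tail e) := by
    intro z
    ext e
    simp [B, Matrix.mulVec, dotProduct, sub_mul, Finset.sum_sub_distrib]
  have hBT : ∀ w, D.IsFlow w → B.transpose.mulVec w = 0 := by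
    intro w hw
    ext v
    have := hw fun u => if v = u then 1 else 0
    simpa [B, Matrix.mulVec, dotProduct, sub_mul, Finset.sum_sub_distrib, sub_eq_zero] using this
  have hrankA : Fintype.card (Face D.rot) ≤ A.rank + 1 := by
    refine card_le_rank_add_one A fun y hy f g => ?_
    refine D.forall_face_of_invariant (fun f => y f = y g) (fun e => ?_) rfl f
    have : y (D.right e) - y (D.left e) = 0 := congrFun ((hA y).symm.trans hy) e
    rw [sub_eq_zero.1 this]
  have hrankB : Fintype.card (Node D.rot) ≤ B.rank + 1 := by
    refine card_le_rank_add_one B fun z hz u v => ?_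
    have hz' : ∀ e, z (D.head e) = z (D.tail e) := fun e =>
      sub_eq_zero.1 (congrFun ((hB z).symm.trans hz) e)
    obtain ⟨h, rfl⟩ := Quotient.exists_rep u
    obtain ⟨k, rfl⟩ := Quotient.exists_rep v
    refine D.forall_halfEdge_of_invariant
      (fun h => z (nodeOf D.rot h) = z (nodeOf D.rot k)) ?_ (fun h => ?_) rfl h
    · rintro ⟨e, b⟩
      have : z (nodeOf D.rot (e, false)) = z (nodeOf D.rot (e, true)) := hz' e
      cases b <;> simp [flip, this]
    · rw [D.nodeOf_rot]
  have heuler := D.euler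
  simp only [Nat.card_eq_fintype_card] at heuler
  have hker := B.transpose.mulVecLin.finrank_range_add_finrank_ker
  rw [Module.finrank_fintype_fun_eq_card, ← Matrix.rank, Matrix.rank_transpose] at hker
  -- Jumps are flows, which gives one inclusion. Jumps have dimension at least `F - 1`, the kernel
  -- at most `E - N + 1`, and Euler's formula equates these bounds.
  have hrange : LinearMap.range A.mulVecLin = LinearMap.ker B.transpose.mulVecLin := by
    refine Submodule.eq_of_le_of_finrank_le ?_ ?_
    · rintro _ ⟨y, rfl⟩
      rw [LinearMap.mem_ker, Matrix.mulVecLin_apply, Matrix.mulVecLin_apply, hA]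
      exact hBT _ (D.isFlow_jump y)
    · rw [← Matrix.rank]
      omega
  have hmem : x ∈ LinearMap.range A.mulVecLin := by
    rw [hrange]
    exact hBT x hx
  obtain ⟨y, hy⟩ := hmem
  refine ⟨y, fun e => ?_⟩
  rw [← hy, Matrix.mulVecLin_apply, hA]

variable {D} in
/-- The energy argument: a flow whose value on each edge is the color times a quantity that
depends only on the head of the edge is proportional to the coloring. -/
theorem IsBalanced.potential_const {c : E → ℕ} (hpos : ∀ e, 0 < c e) (hbal : D.IsBalanced c)
    (σ : Node D.rot → ℚ) (hσ : D.IsFlow (fun e => c e * σ (D.head e))) (u v : Node D.rot) :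
    σ u = σ v := by
  -- Pairing the coloring with `σ ^ 2` and the given flow with `σ` yields exactly the identities
  -- that cancel the expanded energy.
  have h₁ := hbal.isFlow (fun v => σ v ^ 2)
  have h₂ := hσ σ
  have hsum : ∑ e, (c e : ℚ) * (σ (D.head e) - σ (D.tail e)) ^ 2 = 0 := by
    have : ∀ e, (c e : ℚ) * (σ (D.head e) - σ (D.tail e)) ^ 2 =
        2 * (σ (D.head e) * (c e * σ (D.head e))) - 2 * (σ (D.tail e) * (c e * σ (D.head e)))
          - (σ (D.head e) ^ 2 * c e - σ (D.tail e) ^ 2 * c e) := fun e => by ring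
    simp only [this, Finset.sum_sub_distrib, ← Finset.mul_sum]
    linarith
  rw [Finset.sum_eq_zero_iff_of_nonneg fun e _ => by positivity] at hsum
  have hedge : ∀ e, σ (D.head e) = σ (D.tail e) := by
    intro e
    have hc : (c e : ℚ) ≠ 0 := by exact_mod_cast (hpos e).ne'
    have := hsum e (Finset.mem_univ e)
    exact sub_eq_zero.1 (by simpa [hc] using this)
  obtain ⟨h, rfl⟩ := Quotient.exists_rep u
  obtain ⟨k, rfl⟩ := Quotient.exists_rep v
  refine D.forall_halfEdge_of_invariant
    (fun h => σ (nodeOf D.rot h) = σ (nodeOf D.rot k)) ?_ (fun h => ?_) rfl h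
  · rintro ⟨e, b⟩
    have : σ (nodeOf D.rot (e, false)) = σ (nodeOf D.rot (e, true)) := hedge e
    cases b <;> simp [flip, this]
  · rw [D.nodeOf_rot]

/-! ### The index -/

-- The coloring is a flow, hence a jump of a rational function. Once this is shifted to vanish on
-- the unbounded region, integrality spreads across edges because the colors are integers.
variable {D} in
theorem IsBalanced.exists_isIndex {c : E → ℕ} (hbal : D.IsBalanced c) :
    ∃ ind, D.IsIndex c ind := by
  obtain ⟨y, hy⟩ := hbal.isFlow.exists_jump
  have hint : ∀ f, ∃ n : ℤ, y f - y D.outer = n := by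
    refine D.forall_face_of_invariant (f := D.outer) _ (fun e => ?_) ⟨0, by simp⟩
    have := hy e
    constructor
    · rintro ⟨n, hn⟩
      exact ⟨n + c e, by push_cast; linarith⟩
    · rintro ⟨n, hn⟩
      exact ⟨n - c e, by push_cast; linarith⟩
  choose ind hind using hint
  refine ⟨ind, ?_, fun e => ?_⟩
  · have := hind D.outer
    rw [sub_self] at this
    exact_mod_cast this.symm
  · have h₁ := hind (D.right e)
    have h₂ := hind (D.left e)
    have h₃ := hy e
    have : (ind (D.right e) : ℚ) - ind (D.left e) = c e := by linarith
    exact_mod_cast this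

variable {D} in
theorem IsBalanced.isIndex_index {c : E → ℕ} (hbal : D.IsBalanced c) :
    D.IsIndex c (D.index c) :=
  Classical.epsilon_spec hbal.exists_isIndex

variable {D} in
theorem IsBalanced.left_ne_right {c : E → ℕ} (hpos : ∀ e, 0 < c e) (hbal : D.IsBalanced c)
    (e : E) : D.left e ≠ D.right e := by
  intro h
  have h₁ := hbal.isIndex_index.2 e
  have h₂ := hpos e
  rw [h] at h₁
  omega

variable {D} in
theorem IsBalanced.pointFactor_ne_zero {c : E → ℕ} (hpos : ∀ e, 0 < c e) (hbal : D.IsBalanced c)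
    (δ : E) : D.pointFactor c δ ≠ 0 := by
  have h₁ := hbal.isIndex_index.2 δ
  have h₂ := hpos δ
  exact (isPositive_qpow_sub_qpow (by omega)).ne_zero

/-! ### Edges entering a node and the number of crossings -/

variable {D} in
theorem IsBalanced.exists_head_eq_iff {c : E → ℕ} (hpos : ∀ e, 0 < c e) (hbal : D.IsBalanced c)
    (v : Node D.rot) : (∃ e, D.head e = v) ↔ ∃ e, D.tail e = v := by
  classical
  have h := hbal v
  have hiff : ∀ f : E → Node D.rot,
      (∃ e, f e = v) ↔ ∑ e ∈ Finset.univ.filter (fun e : E => f e = v), c e ≠ 0 := by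
    intro f
    simp [Finset.sum_eq_zero_iff, (hpos _).ne']
  rw [hiff, hiff]
  refine not_congr (Eq.congr_left ?_)
  convert h

variable {D} in
theorem IsBalanced.exists_head_eq {c : E → ℕ} (hpos : ∀ e, 0 < c e) (hbal : D.IsBalanced c)
    (v : Node D.rot) : ∃ e, D.head e = v := by
  obtain ⟨⟨e, b⟩, rfl⟩ := Quotient.exists_rep v
  cases b
  · exact ⟨e, rfl⟩
  · exact (hbal.exists_head_eq_iff hpos _).2 ⟨e, rfl⟩

-- Two entering edges and the leaving edge required by balance would make three half-edges at a node
-- of valence 2.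
variable {D} in
theorem IsBalanced.eq_of_head_eq {c : E → ℕ} (hpos : ∀ e, 0 < c e) (hbal : D.IsBalanced c)
    {e e' : E} (h : D.head e = D.head e') (hv : valence (D.head e) ≠ 3) : e = e' := by
  classical
  by_contra hne
  obtain ⟨e'', he''⟩ := (hbal.exists_head_eq_iff hpos _).1 ⟨e, rfl⟩
  have hcard : ({(e, false), (e', false), (e'', true)} : Finset (HalfEdge E)).card = 3 :=
    Finset.card_eq_three.2 ⟨_, _, _, by simpa using hne, by simp, by simp, rfl⟩
  have hle : ({(e, false), (e', false), (e'', true)} : Finset (HalfEdge E)).card ≤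
      valence (D.head e) := by
    rw [valence, Nat.card_eq_fintype_card, Fintype.card_subtype]
    refine Finset.card_le_card fun k hk => ?_
    simp only [Finset.mem_insert, Finset.mem_singleton] at hk
    rw [Finset.mem_filter]
    refine ⟨Finset.mem_univ _, ?_⟩
    rcases hk with rfl | rfl | rfl
    · rfl
    · exact h.symm
    · exact he''
  have := D.valence_eq (D.head e)
  omega

-- Each node of valence 2 has exactly one entering edge, so edges minus crossings equals nodes minus
-- vertices. Euler's formula then leaves all regions but two, and the two regions at `δ` are
-- distinct.
variable {D} in
theorem IsBalanced.card_crossing {c : E → ℕ} (hpos : ∀ e, 0 < c e) (hbal : D.IsBalanced c)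
    (δ : E) : Nat.card D.Crossing =
      Nat.card {R : D.Region // R ≠ Sum.inl (D.left δ) ∧ R ≠ Sum.inl (D.right δ)} := by
  classical
  have := Fintype.ofFinite (Node D.rot)
  have := Fintype.ofFinite (Face D.rot)
  have hbij : Function.Bijective (fun e : {e : E // ¬ valence (D.head e) = 3} =>
      (⟨D.head e.1, e.2⟩ : {v : Node D.rot // ¬ valence v = 3})) := by
    constructor
    · rintro ⟨e, he⟩ ⟨e', he'⟩ h
      exact Subtype.ext (hbal.eq_of_head_eq hpos (congrArg Subtype.val h) he)
    · rintro ⟨v, hv⟩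
      obtain ⟨e, rfl⟩ := hbal.exists_head_eq hpos v
      exact ⟨⟨e, hv⟩, rfl⟩
  have h₁ := Fintype.card_of_bijective hbij
  have h₂ : _ = _ - Fintype.card D.Crossing := Fintype.card_subtype_compl (fun e : E => valence (D.head e) = 3)
  have h₃ : _ = _ - Fintype.card D.Vertex := Fintype.card_subtype_compl (fun v : Node D.rot => valence v = 3)
  have h₄ : Fintype.card D.Crossing ≤ _ := Fintype.card_subtype_le (fun e : E => valence (D.head e) = 3)
  have h₅ : Fintype.card D.Vertex ≤ _ := Fintype.card_subtype_le (fun v : Node D.rot => valence v = 3)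
  have heuler := D.euler
  simp only [Nat.card_eq_fintype_card] at heuler ⊢
  have h₆ : Fintype.card {R : D.Region // R ≠ Sum.inl (D.left δ) ∧ R ≠ Sum.inl (D.right δ)} =
      Fintype.card D.Region - 2 := by
    rw [Fintype.card_subtype, ← Finset.card_univ,
      ← Finset.card_pair (a := (Sum.inl (D.left δ) : D.Region)) (b := Sum.inl (D.right δ))
        (by simpa using hbal.left_ne_right hpos δ),
      ← Finset.card_sdiff_of_subset (Finset.subset_univ _)]
    congr 1
    ext R
    simp
  rw [h₆, Fintype.card_sum]
  omega

/-! ### Existence of a state -/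

variable {D} in
theorem IsBalanced.exists_isState {c : E → ℕ} (hpos : ∀ e, 0 < c e) (hbal : D.IsBalanced c)
    (δ : E) : ∃ s, D.IsState δ s := by
  classical
  have := Fintype.ofFinite (Node D.rot)
  have := Fintype.ofFinite (Face D.rot)
  have hcard := hbal.card_crossing hpos δ
  simp only [Nat.card_eq_fintype_card] at hcard
  -- Only the support of `A` matters for the state; the entries are chosen to make the kernel
  -- equation a discrete flow problem.
  let A : Matrix D.Crossing
      {R : D.Region // R ≠ Sum.inl (D.left δ) ∧ R ≠ Sum.inl (D.right δ)} ℚ :=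
    Matrix.of fun p R =>
      (if R.1 = D.regionAt p Corner.north then (c p.1 : ℚ) else 0) +
        (if R.1 = D.regionAt p Corner.west then 1 else 0) -
        (if R.1 = D.regionAt p Corner.east then 1 else 0)
  have hker : ∀ x, A.mulVec x = 0 → x = 0 := by
    intro x hx
    -- Extension by zero to the two regions at `δ`; these boundary values later force the constant
    -- slope to be zero.
    let X : D.Region → ℚ := fun R =>
      if h : R ≠ Sum.inl (D.left δ) ∧ R ≠ Sum.inl (D.right δ) then x ⟨R, h⟩ else 0
    have hsum : ∀ (a : ℚ) (Q : D.Region),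
        ∑ R : {R : D.Region // R ≠ Sum.inl (D.left δ) ∧ R ≠ Sum.inl (D.right δ)},
          (if R.1 = Q then a else 0) * x R = a * X Q := by
      intro a Q
      by_cases hQ : Q ≠ Sum.inl (D.left δ) ∧ Q ≠ Sum.inl (D.right δ)
      · rw [Finset.sum_eq_single ⟨Q, hQ⟩]
        · simp only [X, dif_pos hQ, if_true]
        · intro R _ hR
          rw [if_neg (fun h => hR (Subtype.ext h)), zero_mul]
        · simp
      · rw [Finset.sum_eq_zero]
        · simp only [X, dif_neg hQ, mul_zero]
        · intro R _
          rw [if_neg (fun h : R.1 = Q => hQ (by rw [← h]; exact R.2)), zero_mul]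
    have hXA : ∀ p : D.Crossing, X (Sum.inl (D.right p.1)) - X (Sum.inl (D.left p.1)) =
        c p.1 * X (Sum.inr ⟨D.head p.1, p.2⟩) := by
      intro p
      have := congrFun hx p
      simp only [A, Matrix.mulVec, dotProduct, Matrix.of_apply, add_mul, sub_mul,
        Finset.sum_add_distrib, Finset.sum_sub_distrib, hsum, one_mul,
        Pi.zero_apply] at this
      simp only [regionAt] at this
      linarith
    have hc : ∀ e, (c e : ℚ) ≠ 0 := fun e => by exact_mod_cast (hpos e).ne'
    let slope : E → ℚ := fun e => (X (Sum.inl (D.right e)) - X (Sum.inl (D.left e))) / c e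
    have hslope : ∀ e, c e * slope e = X (Sum.inl (D.right e)) - X (Sum.inl (D.left e)) :=
      fun e => mul_div_cancel₀ _ (hc e)
    have hslope₃ : ∀ p : D.Crossing, slope p.1 = X (Sum.inr ⟨D.head p.1, p.2⟩) := fun p =>
      mul_left_cancel₀ (hc p.1) ((hslope p.1).trans (hXA p))
    -- At a vertex the slope is the value of `X` inside the circle; at a node of valence 2 only one
    -- edge enters. So the slope is a function of the head.
    have hhead : ∀ e e', D.head e = D.head e' → slope e = slope e' := by
      intro e e' h
      by_cases hv : valence (D.head e) = 3
      · rw [hslope₃ ⟨e, hv⟩, hslope₃ ⟨e', h ▸ hv⟩]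
        simp only [h]
      · rw [hbal.eq_of_head_eq hpos h hv]
    choose entering hentering using hbal.exists_head_eq hpos
    have hσ : ∀ e, slope (entering (D.head e)) = slope e := fun e => hhead _ _ (hentering _)
    have hconst := hbal.potential_const hpos (fun v => slope (entering v)) (by
      simp only [hσ, hslope]
      exact D.isFlow_jump fun f => X (Sum.inl f))
    have hL : X (Sum.inl (D.left δ)) = 0 := dif_neg (by simp)
    have hR : X (Sum.inl (D.right δ)) = 0 := dif_neg (by simp)
    have hzero : ∀ e, slope e = 0 := by
      intro e
      rw [← hσ e]
      refine (hconst _ (D.head δ)).trans ?_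
      rw [hσ]
      simp [slope, hL, hR]
    have hface : ∀ f, X (Sum.inl f) = 0 := by
      refine D.forall_face_of_invariant _ (fun e => ?_) hL
      have := hslope e
      rw [hzero, mul_zero, eq_comm, sub_eq_zero] at this
      rw [this]
    have hvertex : ∀ v : D.Vertex, X (Sum.inr v) = 0 := by
      rintro ⟨v, hv⟩
      obtain ⟨e, rfl⟩ := hbal.exists_head_eq hpos v
      rw [← hslope₃ ⟨e, hv⟩, hzero]
    ext ⟨R, h⟩
    have hXR : X R = x ⟨R, h⟩ := dif_pos h
    rw [← hXR]
    rcases R with f | v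
    · exact hface f
    · exact hvertex v
  obtain ⟨τ, hτ⟩ := exists_equiv_ne_zero hcard A hker
  -- A nonzero entry of `A` can only occur at a region containing a corner of the crossing.
  have hcorner : ∀ p, ∃ k, D.regionAt p k = (τ p).1 := by
    intro p
    by_contra! h
    exact hτ p (by simp [A, (h _).symm])
  choose s hs using hcorner
  refine ⟨s, fun p _ => ?_, fun p _ q _ hpq => ?_, fun R hR => ?_⟩
  · simp only [hs]
    exact (τ p).2
  · simp only [hs] at hpq
    exact τ.injective (Subtype.ext hpq)
  · refine ⟨τ.symm ⟨R, hR⟩, Set.mem_univ _, ?_⟩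
    simp [hs]

/-! ### Nonvanishing of the state sum -/

variable {D} in
theorem IsBalanced.stateSum_ne_zero {c : E → ℕ} (hpos : ∀ e, 0 < c e) (hbal : D.IsBalanced c)
    (δ : E) : D.stateSum c δ ≠ 0 := by
  classical
  obtain ⟨s, hs⟩ := hbal.exists_isState hpos δ
  refine IsPositive.ne_zero (Finset.sum_induction_nonempty _ IsPositive (fun _ _ => .add)
    ⟨s, by simpa using hs⟩ fun s _ => ?_)
  exact Finset.prod_induction _ IsPositive (fun _ _ => .mul) .one
    fun p _ => isPositive_weight (hpos p.1) (s p)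

end PlanarDiagram

end MOY

theorem theorem5p9 {E : Type*} [Fintype E] (D : MOY.PlanarDiagram E) (c : E → ℕ)
    (hpos : ∀ e : E, 0 < c e) (hbal : D.IsBalanced c) (δ : E) :
    D.alexander c δ ≠ 0 := by
  -- The curliness is a power of `t ^ (1 / 4)` whatever the numbers of curves are, so no count of
  -- curves is needed.
  refine mul_ne_zero (div_ne_zero (mul_ne_zero ?_ (MOY.qpow_ne_zero _))
    (mul_ne_zero (hbal.pointFactor_ne_zero hpos δ) (zpow_ne_zero _ ?_)))
    (hbal.stateSum_ne_zero hpos δ)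
  · exact Finset.prod_ne_zero_iff.2 fun e _ => MOY.qpow_ne_zero _
  · exact (MOY.isPositive_qpow_sub_qpow (by norm_num)).ne_zero
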